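/- Write $\mathbb Z_+=\{0,1,2,\dots\}$ and $\mathbb N=\{1,2,\dots\}$. For $S\subseteq\mathbb N$ let $D_S:\ell^1(\mathbb Z_+)\to\ell^1(\mathbb Z_+)^*$ be the bounded linear map determined by $$D_S(\delta_0)=0,\qquad D_S(\delta_j)(\delta_k)=\frac{j}{j+k}\,\chi_S(j+k)\qquad(j\in\mathbb N,\ k\in\mathbb Z_+),$$ where $\ell^1(\mathbb Z_+)$ is the complex convolution algebra and $\chi_S$ is the indicator function of $S$. A set $S\subseteq\mathbb Z_+$ is called a T-set if for every $n\in\mathbb N$ the set $S\cap(S-n)$ is finite, where $S-n=\{t\in\mathbb Z_+: t+n\in S\}$. A bounded linear map is weakly compact if it maps the closed unit ball to a relatively weakly compact set. For $p\in[1,\infty)$, a bounded linear map $T:X\to Y$ between Banach spaces is $p$-summing if there is $C>0$ such that $$\sum_{j=1}^m\|Tx_j\|^p\le C^p\sup_{\phi\in X^*,\,\|\phi\|\le1}\ \sum_{j=1}^m|\phi(x_j)|^p\qquad\text{for all } m\in\mathbb N,\ x_1,\dots,x_m\in X.$$ **Theorem.** There exists a T-set $A\subseteq\mathbb N$ such that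 $D_A$ is a derivation (that is, $D_A(a*b)=a\cdot D_A(b)+D_A(a)\cdot b$ for all $a,b\in\ell^1(\mathbb Z_+)$) which is weakly compact but is not $p$-summing for any $p\in[1,\infty)$. Moreover, $A$ can be taken to be a disjoint union of nonempty finite arithmetic progressions with growing step: there are integers $c_k\ge0$ and $n_k\ge1$ $(k\ge0)$ with $c_k+n_k(k+1)<c_{k+1}$ for all $k$ and $$A=\bigcup_{k\ge0}\{c_k+i(k+1):1\le i\le n_k\}.$$ -/

import Mathlib

open scoped ENNReal

noncomputable section

/-- `S` is a T-set: for every `n ≥ 1`, `S ∩ (S - n)` is finite, where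
`S - n = {t ∈ ℤ₊ : t + n ∈ S}`. -/
def IsTSet (S : Set ℕ) : Prop :=
  ∀ n : ℕ, 1 ≤ n → (S ∩ {t : ℕ | t + n ∈ S}).Finite

/-- The complex sequence space `ℓ¹(ℤ₊)`. -/
abbrev EllOne : Type := lp (fun _ : ℕ => ℂ) 1

/-- The complex sequence space `ℓ^∞(ℤ₊)`. -/
abbrev EllInfty : Type := lp (fun _ : ℕ => ℂ) ∞

theorem EllOne.hasSum_norm (a : EllOne) : HasSum (fun n => ‖a n‖) ‖a‖ := by
  simpa using lp.hasSum_norm (p := 1) (by simp) a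

theorem EllOne.summable_norm (a : EllOne) : Summable (fun n => ‖a n‖) :=
  a.hasSum_norm.summable

/-- The convolution product of `ℓ¹(ℤ₊)`, for which `δ_i * δ_j = δ_{i+j}`. -/
def EllOne.conv (a b : EllOne) : EllOne :=
  ⟨fun n => ∑ ij ∈ Finset.HasAntidiagonal.antidiagonal n, a ij.1 * b ij.2, by
    refine memℓp_gen ?_
    simpa using summable_norm_sum_mul_antidiagonal_of_summable_norm
      a.summable_norm b.summable_norm⟩

/-- A bounded linear map `D : ℓ¹(ℤ₊) → ℓ¹(ℤ₊)*` is a derivation if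
`D (a * b) = a · D b + D a · b`, where the dual carries its usual bimodule structure
`(a · φ) c = φ (c * a)`, `(φ · b) c = φ (b * c)`. -/
def IsDerivation (D : EllOne →L[ℂ] StrongDual ℂ EllOne) : Prop :=
  ∀ a b c : EllOne, D (a.conv b) c = D b (c.conv a) + D a (b.conv c)

/-- The matrix `j / (j + k) * ψ_{j+k}`; the row `j = 0` vanishes, so `ψ₀` plays no role. -/
def derivKernel (ψ : EllInfty) (j k : ℕ) : ℂ :=
  (j : ℂ) / ((j : ℂ) + (k : ℂ)) * ψ (j + k)

theorem norm_derivKernel_le (ψ : EllInfty) (j k : ℕ) : ‖derivKernel ψ j k‖ ≤ ‖ψ‖ := by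
  have h1 : ‖(j : ℂ) / ((j : ℂ) + (k : ℂ))‖ ≤ 1 := by
    rw [norm_div, ← Nat.cast_add, Complex.norm_natCast, Complex.norm_natCast]
    exact div_le_one_of_le₀ (by simp) (Nat.cast_nonneg _)
  have h2 : ‖ψ (j + k)‖ ≤ ‖ψ‖ := lp.norm_apply_le_norm (by simp) ψ (j + k)
  calc ‖derivKernel ψ j k‖ = ‖(j : ℂ) / ((j : ℂ) + (k : ℂ))‖ * ‖ψ (j + k)‖ := norm_mul _ _
    _ ≤ 1 * ‖ψ‖ := mul_le_mul h1 h2 (norm_nonneg _) zero_le_one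
    _ = ‖ψ‖ := one_mul _

theorem norm_derivTerm_le (ψ : EllInfty) (a b : EllOne) (x : ℕ × ℕ) :
    ‖a x.1 * b x.2 * derivKernel ψ x.1 x.2‖ ≤ ‖a x.1‖ * ‖b x.2‖ * ‖ψ‖ := by
  rw [norm_mul, norm_mul]
  exact mul_le_mul_of_nonneg_left (norm_derivKernel_le ψ _ _) (by positivity)

theorem hasSum_derivBound (ψ : EllInfty) (a b : EllOne) :
    HasSum (fun x : ℕ × ℕ => ‖a x.1‖ * ‖b x.2‖ * ‖ψ‖) (‖a‖ * ‖b‖ * ‖ψ‖) :=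
  (a.hasSum_norm.mul b.hasSum_norm
    (a.summable_norm.mul_of_nonneg b.summable_norm (fun _ => norm_nonneg _)
      (fun _ => norm_nonneg _))).mul_right _

theorem summable_derivTerm (ψ : EllInfty) (a b : EllOne) :
    Summable (fun x : ℕ × ℕ => a x.1 * b x.2 * derivKernel ψ x.1 x.2) :=
  Summable.of_norm_bounded (hasSum_derivBound ψ a b).summable (norm_derivTerm_le ψ a b)

/-- The operator `D_ψ : ℓ¹(ℤ₊) → ℓ¹(ℤ₊)*`,
`D_ψ(a)(b) = ∑_{j,k} a_j b_k (j / (j + k)) ψ_{j+k}`. -/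
def derivOp (ψ : EllInfty) : EllOne →L[ℂ] StrongDual ℂ EllOne :=
  LinearMap.mkContinuous₂
    (LinearMap.mk₂ ℂ
      (fun a b : EllOne => ∑' x : ℕ × ℕ, a x.1 * b x.2 * derivKernel ψ x.1 x.2)
      (fun a a' b => by
        rw [← (summable_derivTerm ψ a b).tsum_add (summable_derivTerm ψ a' b)]
        refine tsum_congr fun x => ?_
        rw [lp.coeFn_add, Pi.add_apply]
        ring)
      (fun c a b => by
        rw [smul_eq_mul, ← tsum_mul_left]
        refine tsum_congr fun x => ?_
        rw [lp.coeFn_smul, Pi.smul_apply, smul_eq_mul]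
        ring)
      (fun a b b' => by
        rw [← (summable_derivTerm ψ a b).tsum_add (summable_derivTerm ψ a b')]
        refine tsum_congr fun x => ?_
        rw [lp.coeFn_add, Pi.add_apply]
        ring)
      (fun c a b => by
        rw [smul_eq_mul, ← tsum_mul_left]
        refine tsum_congr fun x => ?_
        rw [lp.coeFn_smul, Pi.smul_apply, smul_eq_mul]
        ring))
    ‖ψ‖
    (fun a b => by
      have h := tsum_of_norm_bounded (hasSum_derivBound ψ a b) (norm_derivTerm_le ψ a b)
      calc _ ≤ ‖a‖ * ‖b‖ * ‖ψ‖ := h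
        _ = ‖ψ‖ * ‖a‖ * ‖b‖ := by ring)

/-- `D_ψ(δ_j)(δ_k) = (j / (j + k)) ψ_{j+k}`. -/
theorem derivOp_single (ψ : EllInfty) (j k : ℕ) :
    derivOp ψ (lp.single 1 j (1 : ℂ)) (lp.single 1 k (1 : ℂ)) =
      (j : ℂ) / ((j : ℂ) + (k : ℂ)) * ψ (j + k) := by
  change ∑' x : ℕ × ℕ, (lp.single 1 j (1 : ℂ) : EllOne) x.1 *
    (lp.single 1 k (1 : ℂ) : EllOne) x.2 * derivKernel ψ x.1 x.2 = _
  rw [tsum_eq_single (j, k)]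
  · simp [derivKernel]
  · rintro ⟨i, l⟩ h
    by_cases h1 : i = j
    · have h2 : l ≠ k := fun h2 => h (by rw [h1, h2])
      simp [lp.single_apply, Pi.single_apply, h2]
    · simp [lp.single_apply, Pi.single_apply, h1]

/-- The indicator function of `S`, as an element of `ℓ^∞(ℤ₊)`. -/
def indicatorInfty (S : Set ℕ) : EllInfty :=
  ⟨S.indicator 1, memℓp_infty ⟨1, by
    rintro _ ⟨n, rfl⟩
    by_cases h : n ∈ S <;> simp [h]⟩⟩

/-- The operator `D_S`, that is, `D_ψ` for the indicator function `ψ` of `S`. -/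
def derivSet (S : Set ℕ) : EllOne →L[ℂ] StrongDual ℂ EllOne :=
  derivOp (indicatorInfty S)

/-- A bounded linear map is weakly compact if the image of the closed unit ball is relatively
compact for the weak topology of the codomain. -/
def IsWeaklyCompactOp {X Y : Type*} [NormedAddCommGroup X] [NormedSpace ℂ X]
    [NormedAddCommGroup Y] [NormedSpace ℂ Y] (T : X →L[ℂ] Y) : Prop :=
  IsCompact (closure ((fun x : X => toWeakSpace ℂ Y (T x)) '' Metric.closedBall (0 : X) 1))

/-- A bounded linear map is `p`-summing if for some `C > 0` and all finite families
`x₁, …, x_m`, `∑ ‖T x_j‖ ^ p ≤ C ^ p * sup_{‖φ‖ ≤ 1} ∑ |φ x_j| ^ p`. The supremum is over a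
nonempty set bounded above by `∑ ‖x_j‖ ^ p` (for `p ≥ 0`). -/
def IsPSumming {X Y : Type*} [NormedAddCommGroup X] [NormedSpace ℂ X]
    [NormedAddCommGroup Y] [NormedSpace ℂ Y] (p : ℝ) (T : X →L[ℂ] Y) : Prop :=
  ∃ C : ℝ, 0 < C ∧ ∀ (m : ℕ) (x : Fin m → X),
    ∑ j, ‖T (x j)‖ ^ p ≤
      C ^ p * ⨆ φ : {φ : StrongDual ℂ X // ‖φ‖ ≤ 1}, ∑ j, ‖φ.1 (x j)‖ ^ p

end

open Filter Topology

namespace EllOne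

/-- The point mass `δ_k` in `ℓ¹(ℤ₊)`. -/
noncomputable abbrev delta (k : ℕ) : EllOne := lp.single 1 k (1 : ℂ)

theorem norm_delta (k : ℕ) : ‖delta k‖ = 1 := by
  simp [delta, lp.norm_single]

theorem single_eq_smul_delta (k : ℕ) (z : ℂ) : (lp.single 1 k z : EllOne) = z • delta k := by
  rw [delta, ← lp.single_smul, smul_eq_mul, mul_one]

theorem hasSum_smul_delta (a : EllOne) : HasSum (fun k => a k • delta k) a := by
  convert lp.hasSum_single (p := 1) (by simp) a using 2 with k
  exact (single_eq_smul_delta k (a k)).symm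

theorem hasSum_map {F : Type*} [NormedAddCommGroup F] [NormedSpace ℂ F] (T : EllOne →L[ℂ] F)
    (a : EllOne) : HasSum (fun k => a k • T (delta k)) (T a) := by
  simpa using T.hasSum (hasSum_smul_delta a)

/-- Bounded linear maps on `ℓ¹(ℤ₊)` are determined by their values at point masses. -/
theorem clm_ext {F : Type*} [NormedAddCommGroup F] [NormedSpace ℂ F] {T U : EllOne →L[ℂ] F}
    (h : ∀ k, T (delta k) = U (delta k)) : T = U := by
  ext a
  have hT := hasSum_map T a
  simp only [h] at hT
  exact hT.unique (hasSum_map U a)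

theorem opNorm_le_of_delta (φ : StrongDual ℂ EllOne) {C : ℝ} (hC : 0 ≤ C)
    (h : ∀ k, ‖φ (delta k)‖ ≤ C) : ‖φ‖ ≤ C := by
  refine φ.opNorm_le_bound hC fun a => ?_
  have hs : HasSum (fun k => C * ‖a k‖) (C * ‖a‖) := a.hasSum_norm.mul_left C
  rw [← (hasSum_map φ a).tsum_eq]
  refine tsum_of_norm_bounded hs fun k => ?_
  rw [norm_smul, mul_comm]
  exact mul_le_mul_of_nonneg_right (h k) (norm_nonneg _)

theorem norm_conv_le (a b : EllOne) : ‖a.conv b‖ ≤ ‖a‖ * ‖b‖ := by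
  have hs := summable_norm_sum_mul_antidiagonal_of_summable_norm
    (f := fun n => ‖a n‖) (g := fun n => ‖b n‖)
    (by simpa using a.summable_norm) (by simpa using b.summable_norm)
  have h2 := tsum_mul_tsum_eq_tsum_sum_antidiagonal_of_summable_norm
    (f := fun n => ‖a n‖) (g := fun n => ‖b n‖)
    (by simpa using a.summable_norm) (by simpa using b.summable_norm)
  rw [a.hasSum_norm.tsum_eq, b.hasSum_norm.tsum_eq] at h2
  rw [h2, ← (a.conv b).hasSum_norm.tsum_eq]
  refine (a.conv b).summable_norm.tsum_le_tsum (fun n => ?_) (Summable.of_norm hs)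
  change ‖∑ x ∈ Finset.HasAntidiagonal.antidiagonal n, a x.1 * b x.2‖ ≤ _
  refine (norm_sum_le _ _).trans_eq ?_
  simp

/-- Convolution on `ℓ¹(ℤ₊)` as a bounded bilinear map. -/
noncomputable def convL : EllOne →L[ℂ] EllOne →L[ℂ] EllOne :=
  LinearMap.mkContinuous₂
    (LinearMap.mk₂ ℂ conv
      (fun a a' b => by
        ext n
        change ∑ x ∈ Finset.HasAntidiagonal.antidiagonal n, (a x.1 + a' x.1) * b x.2 =
          ∑ x ∈ Finset.HasAntidiagonal.antidiagonal n, a x.1 * b x.2 +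
            ∑ x ∈ Finset.HasAntidiagonal.antidiagonal n, a' x.1 * b x.2
        simp only [add_mul, Finset.sum_add_distrib])
      (fun z a b => by
        ext n; simp [conv, Finset.mul_sum, mul_assoc])
      (fun a b b' => by
        ext n
        change ∑ x ∈ Finset.HasAntidiagonal.antidiagonal n, a x.1 * (b x.2 + b' x.2) =
          ∑ x ∈ Finset.HasAntidiagonal.antidiagonal n, a x.1 * b x.2 +
            ∑ x ∈ Finset.HasAntidiagonal.antidiagonal n, a x.1 * b' x.2
        simp only [mul_add, Finset.sum_add_distrib])
      (fun z a b => by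
        ext n; simp [conv, Finset.mul_sum, mul_left_comm]))
    1 (fun a b => by simpa using norm_conv_le a b)

theorem conv_delta_delta (i j : ℕ) : (delta i).conv (delta j) = delta (i + j) := by
  ext n
  change ∑ x ∈ Finset.HasAntidiagonal.antidiagonal n,
    (Pi.single i 1 : ℕ → ℂ) x.1 * (Pi.single j 1 : ℕ → ℂ) x.2 = (Pi.single (i + j) 1 : ℕ → ℂ) n
  by_cases h : n = i + j
  · subst h
    rw [Finset.sum_eq_single (i, j)]
    · simp
    · rintro ⟨k, l⟩ hkl hne
      have hk : k ≠ i := by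
        rintro rfl
        exact hne (by simpa using hkl)
      simp [hk]
    · simp
  · rw [Pi.single_eq_of_ne h]
    refine Finset.sum_eq_zero ?_
    rintro ⟨k, l⟩ hkl
    rw [Finset.HasAntidiagonal.mem_antidiagonal] at hkl
    by_cases hk : k = i
    · have hl : l ≠ j := by
        rintro rfl
        exact h (by rw [← hkl, hk])
      simp [hl]
    · simp [hk]

/-- The coordinate functional `a ↦ a_k` on `ℓ¹(ℤ₊)`. -/
noncomputable abbrev coord (k : ℕ) : StrongDual ℂ EllOne :=
  lp.evalCLM ℂ (fun _ : ℕ => ℂ) 1 k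

theorem coord_delta (k l : ℕ) : coord k (delta l) = if k = l then 1 else 0 := by
  change (Pi.single l 1 : ℕ → ℂ) k = _
  rw [Pi.single_apply]

theorem sum_smul_coord_delta (s : Finset ℕ) (z : ℕ → ℂ) (l : ℕ) :
    (∑ k ∈ s, z k • coord k) (delta l) = if l ∈ s then z l else 0 := by
  simp only [sum_apply, smul_apply, coord_delta]
  simp

/-- A functional whose values at point masses tend to zero is the norm-convergent sum of its
coordinates. -/
theorem hasSum_smul_coord {φ : StrongDual ℂ EllOne}
    (hφ : Tendsto (fun k => φ (delta k)) atTop (𝓝 0)) :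
    HasSum (fun k => φ (delta k) • coord k) φ := by
  rw [HasSum, SummationFilter.unconditional_filter, Metric.tendsto_nhds]
  intro ε hε
  obtain ⟨N, hN⟩ := Metric.tendsto_atTop.1 hφ (ε / 2) (by positivity)
  filter_upwards [eventually_ge_atTop (Finset.range N)] with s hs
  rw [dist_eq_norm]
  refine lt_of_le_of_lt (opNorm_le_of_delta _ (C := ε / 2) (by positivity) fun k => ?_)
    (by linarith)
  rw [sub_apply, sum_smul_coord_delta]
  split_ifs with hk
  · simpa using (half_pos hε).le
  · have : N ≤ k := by
      by_contra hlt
      exact hk (hs (Finset.mem_range.2 (not_le.1 hlt)))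
    simpa using (hN k this).le

theorem summable_norm_dual_coord (μ : StrongDual ℂ (StrongDual ℂ EllOne)) :
    Summable fun k => ‖μ (coord k)‖ := by
  refine summable_of_sum_le (c := ‖μ‖) (fun _ => norm_nonneg _) fun s => ?_
  choose z hz1 hz using fun k => Complex.exists_norm_eq_mul_self (μ (coord k))
  have hnorm : ‖∑ k ∈ s, z k • coord k‖ ≤ 1 := by
    refine opNorm_le_of_delta _ zero_le_one fun l => ?_
    rw [sum_smul_coord_delta]
    split_ifs <;> simp [hz1]
  have heq : ((∑ k ∈ s, ‖μ (coord k)‖ : ℝ) : ℂ) = μ (∑ k ∈ s, z k • coord k) := by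
    simp [hz]
  calc ∑ k ∈ s, ‖μ (coord k)‖ = ‖((∑ k ∈ s, ‖μ (coord k)‖ : ℝ) : ℂ)‖ := by
        rw [Complex.norm_real, Real.norm_of_nonneg (by positivity)]
    _ ≤ ‖μ‖ * ‖∑ k ∈ s, z k • coord k‖ := by rw [heq]; exact μ.le_opNorm _
    _ ≤ ‖μ‖ := mul_le_of_le_one_right (norm_nonneg μ) hnorm

end EllOne

open EllOne

/-- Every operator `D_ψ` is a derivation. -/
theorem isDerivation_derivOp (ψ : EllInfty) : IsDerivation (derivOp ψ) := by
  set D := derivOp ψ with hD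
  have hdelta : ∀ i j k, D ((delta i).conv (delta j)) (delta k) =
      D (delta j) ((delta k).conv (delta i)) + D (delta i) ((delta j).conv (delta k)) := by
    intro i j k
    rw [conv_delta_delta, conv_delta_delta, conv_delta_delta, hD, derivOp_single, derivOp_single,
      derivOp_single, show k + i = i + k from add_comm _ _,
      show j + (i + k) = i + j + k by ring, show i + (j + k) = i + j + k by ring]
    push_cast
    rw [show (j : ℂ) + (i + k) = i + j + k by ring, show (i : ℂ) + (j + k) = i + j + k by ring]
    ring
  have hc : ∀ i j, D ((delta i).conv (delta j)) =
      (D (delta j)) ∘L (convL.flip (delta i)) + (D (delta i)) ∘L (convL (delta j)) :=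
    fun i j => clm_ext fun k => hdelta i j k
  intro a b c
  have hb : ∀ i, ((ContinuousLinearMap.apply ℂ ℂ c) ∘L D) ∘L (convL (delta i)) =
      (ContinuousLinearMap.apply ℂ ℂ (c.conv (delta i))) ∘L D +
        (D (delta i)) ∘L (convL.flip c) :=
    fun i => clm_ext fun j => DFunLike.congr_fun (hc i j) c
  have ha : ((ContinuousLinearMap.apply ℂ ℂ c) ∘L D) ∘L (convL.flip b) =
      (D b) ∘L (convL c) + (ContinuousLinearMap.apply ℂ ℂ (b.conv c)) ∘L D :=
    clm_ext fun i => DFunLike.congr_fun (hb i) b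
  exact DFunLike.congr_fun ha a

/-- An operator `D : ℓ¹ → (ℓ¹)*` with weakly null columns is weakly compact. -/
theorem isWeaklyCompactOp_of_tendsto (D : EllOne →L[ℂ] StrongDual ℂ EllOne)
    (hcol : ∀ Φ : StrongDual ℂ (StrongDual ℂ EllOne),
      Tendsto (fun k => Φ (D.flip (delta k))) atTop (𝓝 0)) : IsWeaklyCompactOp D := by
  let G : WeakDual ℂ (StrongDual ℂ EllOne) → WeakSpace ℂ (StrongDual ℂ EllOne) :=
    fun Φ => toWeakSpace ℂ _ (Φ.toStrongDual ∘L D.flip)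
  have hG : Continuous G := by
    refine WeakBilin.continuous_of_continuous_eval _ fun μ => ?_
    let b : EllOne := ⟨fun k => μ (coord k), memℓp_gen (by simpa using summable_norm_dual_coord μ)⟩
    have hval : ∀ Φ : WeakDual ℂ (StrongDual ℂ EllOne),
        μ (Φ.toStrongDual ∘L D.flip) = Φ (D.flip b) := by
      intro Φ
      have h1 := μ.hasSum (hasSum_smul_coord (φ := Φ.toStrongDual ∘L D.flip)
        (hcol Φ.toStrongDual))
      have h2 := hasSum_map (Φ.toStrongDual ∘L D.flip) b
      have hterm : (fun k => μ ((Φ.toStrongDual ∘L D.flip) (delta k) • coord k)) =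
          fun k => b k • (Φ.toStrongDual ∘L D.flip) (delta k) := by
        funext k
        rw [map_smul, smul_eq_mul, smul_eq_mul, mul_comm]
      rw [hterm] at h1
      exact h1.unique h2
    exact (WeakDual.eval_continuous (D.flip b)).congr fun Φ => (hval Φ).symm
  have hK := (WeakDual.isCompact_closedBall (𝕜 := ℂ) (0 : StrongDual ℂ (StrongDual ℂ EllOne))
    1).image hG
  refine hK.closure_of_subset ?_
  rintro _ ⟨x, hx, rfl⟩
  refine ⟨StrongDual.toWeakDual (ContinuousLinearMap.apply ℂ ℂ x), ?_, ?_⟩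
  · rw [Set.mem_preimage, mem_closedBall_zero_iff]
    refine ContinuousLinearMap.opNorm_le_bound _ zero_le_one fun φ => ?_
    rw [one_mul]
    exact φ.unit_le_opNorm x (mem_closedBall_zero_iff.1 hx)
  · rfl

theorem norm_derivKernel_indicatorInfty_le (S : Set ℕ) (j k : ℕ) :
    ‖derivKernel (indicatorInfty S) j k‖ ≤ 1 := by
  refine (norm_derivKernel_le _ _ _).trans (lp.norm_le_of_forall_le zero_le_one fun n => ?_)
  change ‖S.indicator (1 : ℕ → ℂ) n‖ ≤ 1
  by_cases h : n ∈ S <;> simp [h]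

theorem derivKernel_indicatorInfty_of_mem {S : Set ℕ} {j k : ℕ} (h : j + k ∈ S) :
    derivKernel (indicatorInfty S) j k = (((j : ℝ) / (j + k) : ℝ) : ℂ) := by
  change (j : ℂ) / ((j : ℂ) + (k : ℂ)) * S.indicator (1 : ℕ → ℂ) (j + k) = _
  simp [h]

theorem derivKernel_indicatorInfty_of_notMem {S : Set ℕ} {j k : ℕ} (h : j + k ∉ S) :
    derivKernel (indicatorInfty S) j k = 0 := by
  change (j : ℂ) / ((j : ℂ) + (k : ℂ)) * S.indicator (1 : ℕ → ℂ) (j + k) = _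
  simp [h]

theorem norm_derivKernel_indicatorInfty_le_div (S : Set ℕ) (j k : ℕ) :
    ‖derivKernel (indicatorInfty S) j k‖ ≤ j / (j + k) := by
  by_cases h : j + k ∈ S
  · rw [derivKernel_indicatorInfty_of_mem h, Complex.norm_real, Real.norm_of_nonneg (by positivity)]
  · rw [derivKernel_indicatorInfty_of_notMem h, norm_zero]
    positivity

theorem derivSet_delta_delta (S : Set ℕ) (j k : ℕ) :
    derivSet S (delta j) (delta k) = derivKernel (indicatorInfty S) j k :=
  derivOp_single _ j k

namespace IsTSet

variable {S : Set ℕ}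

theorem eventually_not_and (hS : IsTSet S) {k l : ℕ} (hkl : k ≠ l) :
    ∀ᶠ j in atTop, ¬ (j + k ∈ S ∧ j + l ∈ S) := by
  wlog h : k < l generalizing k l
  · filter_upwards [this hkl.symm (by omega)] with j hj hj'
    exact hj hj'.symm
  obtain ⟨B, hB⟩ := (hS (l - k) (by omega)).bddAbove
  filter_upwards [eventually_gt_atTop B] with j hj hmem
  have := hB (show j + k ∈ _ from ⟨hmem.1, by
    change j + k + (l - k) ∈ S
    rw [show j + k + (l - k) = j + l by omega]
    exact hmem.2⟩)
  omega

theorem eventually_sum_norm_derivKernel_le_one (hS : IsTSet S) (F : Finset ℕ) :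
    ∀ᶠ j in atTop, ∑ k ∈ F, ‖derivKernel (indicatorInfty S) j k‖ ≤ 1 := by
  have h : ∀ᶠ j in atTop, ∀ k ∈ F, ∀ l ∈ F, k ≠ l → ¬ (j + k ∈ S ∧ j + l ∈ S) := by
    rw [Finset.eventually_all]
    intro k _
    rw [Finset.eventually_all]
    intro l _
    by_cases hkl : k = l
    · simp [hkl]
    · filter_upwards [hS.eventually_not_and hkl] with j hj _ using hj
  filter_upwards [h] with j hj
  by_cases hex : ∃ k ∈ F, j + k ∈ S
  · obtain ⟨k, hk, hkS⟩ := hex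
    rw [Finset.sum_eq_single k]
    · exact norm_derivKernel_indicatorInfty_le S j k
    · intro l hl hlk
      rw [derivKernel_indicatorInfty_of_notMem, norm_zero]
      exact fun hlS => hj k hk l hl hlk.symm ⟨hkS, hlS⟩
    · exact fun h => (h hk).elim
  · rw [Finset.sum_eq_zero]
    · exact zero_le_one
    · intro k hk
      rw [derivKernel_indicatorInfty_of_notMem, norm_zero]
      exact fun hkS => hex ⟨k, hk, hkS⟩

/-- Inside any infinite set of columns there are arbitrarily many whose absolute values have
uniformly bounded sum. -/
theorem exists_finset_sum_norm_derivKernel_le (hS : IsTSet S) {P : ℕ → Prop}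
    (hP : ∃ᶠ k in atTop, P k) (N : ℕ) :
    ∃ F : Finset ℕ, F.card = N ∧ (∀ k ∈ F, P k) ∧
      ∀ j, ∑ k ∈ F, ‖derivKernel (indicatorInfty S) j k‖ ≤ 3 - (1 / 2 : ℝ) ^ N := by
  induction N with
  | zero => exact ⟨∅, by simp, by simp, fun j => by norm_num⟩
  | succ N ih =>
    obtain ⟨F, hcard, hF, hsum⟩ := ih
    obtain ⟨J, hJ⟩ := eventually_atTop.1 (hS.eventually_sum_norm_derivKernel_le_one F)
    obtain ⟨k, ⟨hk1, hk2⟩, hkP⟩ := (((eventually_gt_atTop (F.sup id)).and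
      (eventually_ge_atTop (J * 2 ^ (N + 1)))).and_frequently hP).exists
    have hkF : k ∉ F := fun h => absurd (Finset.le_sup (f := id) h) (by simpa using hk1)
    have hpow : (1 / 2 : ℝ) ^ (N + 1) ≤ 1 := pow_le_one₀ (by norm_num) (by norm_num)
    refine ⟨insert k F, by rw [Finset.card_insert_of_notMem hkF, hcard], ?_, fun j => ?_⟩
    · intro l hl
      rcases Finset.mem_insert.1 hl with rfl | hl
      · exact hkP
      · exact hF l hl
    · rw [Finset.sum_insert hkF]
      rcases le_or_gt J j with hj | hj
      · linarith [hJ j hj, norm_derivKernel_indicatorInfty_le S j k]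
      · have hsmall : (j : ℝ) / (j + k) ≤ (1 / 2 : ℝ) ^ (N + 1) := by
          have hk0 : 0 < k := by omega
          have hjk : (j : ℝ) * 2 ^ (N + 1) ≤ k := by
            exact_mod_cast (Nat.mul_le_mul_right _ hj.le).trans hk2
          rw [one_div, inv_pow, div_le_iff₀ (by positivity), ← div_eq_inv_mul,
            le_div_iff₀ (by positivity)]
          linarith [(Nat.cast_nonneg j : (0 : ℝ) ≤ j)]
        have hhalf : (1 / 2 : ℝ) ^ N = 2 * (1 / 2 : ℝ) ^ (N + 1) := by ring
        linarith [hsum j, norm_derivKernel_indicatorInfty_le_div S j k]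

theorem tendsto_dual_flip_derivSet (hS : IsTSet S) (Φ : StrongDual ℂ (StrongDual ℂ EllOne)) :
    Tendsto (fun k => Φ ((derivSet S).flip (delta k))) atTop (𝓝 0) := by
  by_contra hnot
  rw [Metric.tendsto_nhds] at hnot
  push Not at hnot
  obtain ⟨ε, hε, hfreq⟩ := hnot
  simp only [dist_zero_right] at hfreq
  obtain ⟨N, hN⟩ := exists_nat_gt (‖Φ‖ * 3 / ε)
  obtain ⟨F, hcard, hF, hsum⟩ := hS.exists_finset_sum_norm_derivKernel_le hfreq N
  choose z hz1 hz using
    fun k => Complex.exists_norm_eq_mul_self (Φ ((derivSet S).flip (delta k)))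
  have hnorm : ‖∑ k ∈ F, z k • (derivSet S).flip (delta k)‖ ≤ 3 := by
    refine opNorm_le_of_delta _ (by norm_num) fun j => ?_
    rw [sum_apply]
    refine (norm_sum_le _ _).trans (le_trans (le_of_eq ?_)
      ((hsum j).trans (sub_le_self _ (by positivity))))
    refine Finset.sum_congr rfl fun k _ => ?_
    rw [smul_apply, norm_smul, hz1, one_mul, ContinuousLinearMap.flip_apply, derivSet_delta_delta]
  have heq : ((∑ k ∈ F, ‖Φ ((derivSet S).flip (delta k))‖ : ℝ) : ℂ) =
      Φ (∑ k ∈ F, z k • (derivSet S).flip (delta k)) := by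
    simp [hz]
  have hupper : ∑ k ∈ F, ‖Φ ((derivSet S).flip (delta k))‖ ≤ ‖Φ‖ * 3 := by
    calc ∑ k ∈ F, ‖Φ ((derivSet S).flip (delta k))‖
        = ‖((∑ k ∈ F, ‖Φ ((derivSet S).flip (delta k))‖ : ℝ) : ℂ)‖ := by
          rw [Complex.norm_real, Real.norm_of_nonneg (by positivity)]
      _ ≤ ‖Φ‖ * ‖∑ k ∈ F, z k • (derivSet S).flip (delta k)‖ := by
          rw [heq]; exact Φ.le_opNorm _
      _ ≤ ‖Φ‖ * 3 := mul_le_mul_of_nonneg_left hnorm (norm_nonneg Φ)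
  have hlower : N * ε ≤ ∑ k ∈ F, ‖Φ ((derivSet S).flip (delta k))‖ := by
    rw [← hcard, ← nsmul_eq_mul]
    exact Finset.card_nsmul_le_sum _ _ _ hF
  rw [div_lt_iff₀ hε] at hN
  linarith

theorem isWeaklyCompactOp_derivSet (hS : IsTSet S) : IsWeaklyCompactOp (derivSet S) :=
  isWeaklyCompactOp_of_tendsto _ hS.tendsto_dual_flip_derivSet

end IsTSet

/-- A union of finite arithmetic progressions with steps `1, 2, 3, …`, each lying beyond the
previous one, is a T-set. -/
theorem isTSet_iUnion_progression {c n : ℕ → ℕ} (hc : ∀ k, c k + n k * (k + 1) < c (k + 1)) :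
    IsTSet (⋃ k : ℕ, (fun i : ℕ => c k + i * (k + 1)) '' Set.Icc 1 (n k)) := by
  have hmono : StrictMono c := strictMono_nat_of_lt_succ fun k =>
    (Nat.le_add_right _ _).trans_lt (hc k)
  intro m hm
  refine (Set.finite_Iic (c m)).subset ?_
  rintro t ⟨ht, htm⟩
  simp only [Set.mem_ofPred_eq, Set.mem_iUnion, Set.mem_image, Set.mem_Icc] at ht htm
  obtain ⟨k, i, ⟨hi1, hi2⟩, rfl⟩ := ht
  obtain ⟨l, i', ⟨hi1', hi2'⟩, h⟩ := htm
  have hle : c k + i * (k + 1) < c (k + 1) :=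
    (Nat.add_le_add_left (Nat.mul_le_mul_right _ hi2) _).trans_lt (hc k)
  have hle' : c l + i' * (l + 1) < c (l + 1) :=
    (Nat.add_le_add_left (Nat.mul_le_mul_right _ hi2') _).trans_lt (hc l)
  suffices k < m from Set.mem_Iic.2 (hle.le.trans (hmono.monotone this))
  rcases lt_trichotomy l k with hlk | rfl | hkl
  · have := hmono.monotone (show l + 1 ≤ k from hlk)
    omega
  · have hdvd : l + 1 ∣ m := by
      have : i' * (l + 1) = i * (l + 1) + m := by omega
      exact (Nat.dvd_add_right (Dvd.intro_left i rfl)).1 (this ▸ Dvd.intro_left i' rfl)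
    exact Nat.le_of_dvd (by omega) hdvd
  · have := hmono.monotone (show k + 1 ≤ l from hkl)
    have : l + 1 ≤ i' * (l + 1) := Nat.le_mul_of_pos_left _ hi1'
    omega

section Haar

variable {X Y : Type*} [NormedAddCommGroup X] [NormedSpace ℂ X]
  [NormedAddCommGroup Y] [NormedSpace ℂ Y]

/-- The average of the terms of `e` with index in the dyadic interval `[m 2^s, (m + 1) 2^s)`. -/
noncomputable def dyadicAvg (e : ℕ → X) : ℕ → ℕ → X
  | 0, m => e m
  | s + 1, m => (2⁻¹ : ℂ) • (dyadicAvg e s (2 * m) + dyadicAvg e s (2 * m + 1))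

/-- Half the difference of the averages of `e` over the two halves of the dyadic interval
`[m 2^(s+1), (m + 1) 2^(s+1))`. -/
noncomputable def dyadicDiff (e : ℕ → X) (s m : ℕ) : X :=
  (2⁻¹ : ℂ) • (dyadicAvg e s (2 * m) - dyadicAvg e s (2 * m + 1))

theorem map_dyadicAvg (T : X →L[ℂ] Y) (e : ℕ → X) (s m : ℕ) :
    T (dyadicAvg e s m) = dyadicAvg (fun i => T (e i)) s m := by
  induction s generalizing m with
  | zero => rfl
  | succ s ih => simp only [dyadicAvg, map_smul, map_add, ih]

theorem map_dyadicDiff (T : X →L[ℂ] Y) (e : ℕ → X) (s m : ℕ) :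
    T (dyadicDiff e s m) = dyadicDiff (fun i => T (e i)) s m := by
  simp only [dyadicDiff, map_smul, map_sub, map_dyadicAvg]

theorem dyadicAvg_induction {P : X → Prop} (hP : ∀ a b, P a → P b → P ((2⁻¹ : ℂ) • (a + b)))
    (e : ℕ → X) (s m : ℕ) (h : ∀ i, m * 2 ^ s ≤ i → i < (m + 1) * 2 ^ s → P (e i)) :
    P (dyadicAvg e s m) := by
  induction s generalizing m with
  | zero => exact h m (by simp) (by simp)
  | succ s ih =>
    have hpos : 0 < 2 ^ s := by positivity
    refine hP _ _ (ih _ fun i h1 h2 => h i ?_ ?_) (ih _ fun i h1 h2 => h i ?_ ?_) <;>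
    · rw [pow_succ]
      nlinarith

theorem norm_dyadicAvg_le_one {e : ℕ → X} (he : ∀ i, ‖e i‖ ≤ 1) (s m : ℕ) :
    ‖dyadicAvg e s m‖ ≤ 1 := by
  refine dyadicAvg_induction (P := fun x => ‖x‖ ≤ 1) (fun a b ha hb => ?_) e s m
    fun i _ _ => he i
  rw [norm_smul, norm_inv, Complex.norm_ofNat]
  linarith [norm_add_le a b]

theorem norm_dyadicDiff_le_one {e : ℕ → X} (he : ∀ i, ‖e i‖ ≤ 1) (s m : ℕ) :
    ‖dyadicDiff e s m‖ ≤ 1 := by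
  rw [dyadicDiff, norm_smul, norm_inv, Complex.norm_ofNat]
  linarith [norm_sub_le (dyadicAvg e s (2 * m)) (dyadicAvg e s (2 * m + 1)),
    norm_dyadicAvg_le_one he s (2 * m), norm_dyadicAvg_le_one he s (2 * m + 1)]

theorem le_norm_dyadicDiff {f : ℕ → ℂ} {r : ℝ} {s m : ℕ}
    (hleft : ∀ i, i < (2 * m + 1) * 2 ^ s → 2 * r ≤ (f i).re)
    (hright : ∀ i, (2 * m + 1) * 2 ^ s ≤ i → i < (2 * m + 1 + 1) * 2 ^ s → f i = 0) :
    r ≤ ‖dyadicDiff f s m‖ := by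
  have hre : ∀ z : ℂ, ((2⁻¹ : ℂ) • z).re = z.re / 2 := fun z => by
    simp
    ring
  have h1 : 2 * r ≤ (dyadicAvg f s (2 * m)).re := by
    refine dyadicAvg_induction (P := fun z : ℂ => 2 * r ≤ z.re) (fun a b ha hb => ?_) f s (2 * m)
      fun i _ hi => hleft i hi
    rw [hre, Complex.add_re]
    linarith
  have h2 : dyadicAvg f s (2 * m + 1) = 0 :=
    dyadicAvg_induction (P := fun z : ℂ => z = 0) (fun a b ha hb => by simp [ha, hb]) f s
      (2 * m + 1) hright
  refine le_trans ?_ (Complex.re_le_norm _)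
  rw [dyadicDiff, h2, sub_zero, hre]
  linarith

theorem sum_range_two_mul_eq {M : Type*} [AddCommMonoid M] (f : ℕ → M) (n : ℕ) :
    ∑ i ∈ Finset.range (2 * n), f i = ∑ i ∈ Finset.range n, (f (2 * i) + f (2 * i + 1)) := by
  induction n with
  | zero => simp
  | succ n ih =>
    rw [show 2 * (n + 1) = 2 * n + 1 + 1 by ring, Finset.sum_range_succ, Finset.sum_range_succ, ih,
      Finset.sum_range_succ, add_assoc]

theorem sum_norm_sq_dyadic_succ (f : ℕ → ℂ) (s n : ℕ) :
    2 * ∑ m ∈ Finset.range n, ‖dyadicAvg f (s + 1) m‖ ^ 2 +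
      2 * ∑ m ∈ Finset.range n, ‖dyadicDiff f s m‖ ^ 2 =
    ∑ m ∈ Finset.range (2 * n), ‖dyadicAvg f s m‖ ^ 2 := by
  rw [sum_range_two_mul_eq, Finset.mul_sum, Finset.mul_sum, ← Finset.sum_add_distrib]
  refine Finset.sum_congr rfl fun m _ => ?_
  have h := parallelogram_law_with_norm ℝ (dyadicAvg f s (2 * m)) (dyadicAvg f s (2 * m + 1))
  simp only [dyadicAvg, dyadicDiff, norm_smul, norm_inv, Complex.norm_ofNat, mul_pow]
  linarith

theorem sum_norm_sq_dyadicDiff_add (f : ℕ → ℂ) {t L : ℕ} (ht : t ≤ L) :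
    ∑ s ∈ Finset.range t, ∑ m ∈ Finset.range (2 ^ (L - 1 - s)),
        (2 : ℝ) ^ (s + 1) * ‖dyadicDiff f s m‖ ^ 2 +
      2 ^ t * ∑ m ∈ Finset.range (2 ^ (L - t)), ‖dyadicAvg f t m‖ ^ 2 =
    ∑ m ∈ Finset.range (2 ^ L), ‖f m‖ ^ 2 := by
  induction t with
  | zero => simp [dyadicAvg]
  | succ t ih =>
    rw [← ih (by omega), Finset.sum_range_succ, show L - t = (L - 1 - t) + 1 by omega,
      show L - (t + 1) = L - 1 - t by omega, pow_succ 2 (L - 1 - t), mul_comm (2 ^ (L - 1 - t)) 2,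
      ← sum_norm_sq_dyadic_succ, ← Finset.mul_sum]
    ring

/-- Bessel's inequality for the Haar system on `2^L` points. -/
theorem sum_norm_sq_dyadicDiff_le {f : ℕ → ℂ} (hf : ∀ i, ‖f i‖ ≤ 1) (L : ℕ) :
    ∑ s ∈ Finset.range L, ∑ m ∈ Finset.range (2 ^ (L - 1 - s)),
      (2 : ℝ) ^ (s + 1) / 2 ^ L * ‖dyadicDiff f s m‖ ^ 2 ≤ 1 := by
  have h := sum_norm_sq_dyadicDiff_add f (le_refl L)
  have h1 : ∑ m ∈ Finset.range (2 ^ L), ‖f m‖ ^ 2 ≤ 2 ^ L := by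
    refine (Finset.sum_le_card_nsmul _ _ 1 fun m _ => pow_le_one₀ (norm_nonneg _) (hf m)).trans ?_
    simp
  have h2 : 0 ≤ (2 : ℝ) ^ L * ∑ m ∈ Finset.range (2 ^ (L - L)), ‖dyadicAvg f L m‖ ^ 2 := by
    positivity
  simp only [div_mul_eq_mul_div, ← Finset.sum_div]
  rw [div_le_one (by positivity)]
  linarith

theorem sum_dyadic_weight (L : ℕ) :
    ∑ s ∈ Finset.range L, ∑ _m ∈ Finset.range (2 ^ (L - 1 - s)), (2 : ℝ) ^ (s + 1) / 2 ^ L = L := by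
  rw [Finset.sum_congr rfl (g := fun _ => (1 : ℝ))]
  · simp
  · intro s hs
    have hs := Finset.mem_range.1 hs
    rw [Finset.sum_const, Finset.card_range, nsmul_eq_mul, Nat.cast_pow, Nat.cast_ofNat,
      ← mul_div_assoc, ← pow_add, show L - 1 - s + (s + 1) = L by omega,
      div_self (by positivity)]

theorem norm_map_rpow_smul_rpow {p : ℝ} (hp : 0 < p) {w : ℝ} (hw : 0 ≤ w) (T : X →L[ℂ] Y) (x : X) :
    ‖T (((w ^ p⁻¹ : ℝ) : ℂ) • x)‖ ^ p = w * ‖T x‖ ^ p := by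
  have hw' : 0 ≤ w ^ p⁻¹ := Real.rpow_nonneg hw _
  rw [map_smul, norm_smul, Complex.norm_real, Real.norm_of_nonneg hw',
    Real.mul_rpow hw' (norm_nonneg _), Real.rpow_inv_rpow hw hp.ne']

/-- The inequality defining `p`-summing operators, for weighted families. -/
theorem IsPSumming.exists_weighted {p : ℝ} (hp : 0 < p) {T : X →L[ℂ] Y} (hT : IsPSumming p T) :
    ∃ C : ℝ, 0 < C ∧ ∀ (ι : Type) (s : Finset ι) (w : ι → ℝ) (x : ι → X) (B : ℝ),
      (∀ i, 0 ≤ w i) →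
      (∀ φ : StrongDual ℂ X, ‖φ‖ ≤ 1 → ∑ i ∈ s, w i * ‖φ (x i)‖ ^ p ≤ B) →
      ∑ i ∈ s, w i * ‖T (x i)‖ ^ p ≤ C ^ p * B := by
  obtain ⟨C, hC, h⟩ := hT
  refine ⟨C, hC, fun ι s w x B hw hB => ?_⟩
  have hsum : ∀ g : ι → ℝ, ∑ j, g (s.equivFin.symm j) = ∑ i ∈ s, g i := by
    intro g
    rw [s.equivFin.symm.sum_comp (fun i : s => g i), Finset.sum_coe_sort]
  replace h := h s.card fun j =>
    ((w (s.equivFin.symm j) ^ p⁻¹ : ℝ) : ℂ) • x (s.equivFin.symm j)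
  simp only [fun i => norm_map_rpow_smul_rpow hp (hw i) T (x i)] at h
  rw [hsum fun i => w i * ‖T (x i)‖ ^ p] at h
  refine h.trans (mul_le_mul_of_nonneg_left ?_ (by positivity))
  have : Nonempty {φ : StrongDual ℂ X // ‖φ‖ ≤ 1} := ⟨⟨0, by simp⟩⟩
  refine ciSup_le fun φ => ?_
  simp only [fun i => norm_map_rpow_smul_rpow hp (hw i) φ.1 (x i)]
  rw [hsum fun i => w i * ‖φ.1 (x i)‖ ^ p]
  exact hB φ.1 φ.2

/-- An operator that is bounded below on arbitrarily long Haar systems of normalized sequences is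
not `p`-summing for any `p`. -/
theorem not_isPSumming_of_dyadicDiff {T : X →L[ℂ] Y} {r : ℝ} (hr : 0 < r)
    (h : ∀ L : ℕ, ∃ e : ℕ → X, (∀ i, ‖e i‖ ≤ 1) ∧
      ∀ s < L, ∀ m < 2 ^ (L - 1 - s), r ≤ ‖T (dyadicDiff e s m)‖)
    {p : ℝ} (hp : 1 ≤ p) : ¬ IsPSumming p T := by
  intro hT
  obtain ⟨C, hC, hw⟩ := hT.exists_weighted (by linarith)
  obtain ⟨t, ht⟩ := exists_nat_gt (C ^ p / r ^ p)
  have ht0 : (0 : ℝ) < t := lt_trans (by positivity) ht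
  obtain ⟨e, he, hlow⟩ := h (t ^ 2)
  set L := t ^ 2 with hL
  have key := hw (Σ _ : ℕ, ℕ) ((Finset.range L).sigma fun s => Finset.range (2 ^ (L - 1 - s)))
    (fun i => (2 : ℝ) ^ (i.1 + 1) / 2 ^ L) (fun i => dyadicDiff e i.1 i.2) t
    (fun i => by positivity) ?_
  · have hsum : (L : ℝ) * r ^ p ≤ C ^ p * t := by
      refine le_trans ?_ key
      rw [← sum_dyadic_weight, Finset.sum_sigma, Finset.sum_mul]
      refine Finset.sum_le_sum fun s hs => ?_
      rw [Finset.sum_mul]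
      refine Finset.sum_le_sum fun m hm => ?_
      have := hlow s (Finset.mem_range.1 hs) m (Finset.mem_range.1 hm)
      gcongr
    rw [div_lt_iff₀ (by positivity)] at ht
    have : C ^ p * t < (t * r ^ p) * t := mul_lt_mul_of_pos_right ht ht0
    rw [hL] at hsum
    push_cast at hsum
    nlinarith
  · intro φ hφ
    have hφe : ∀ i, ‖φ (e i)‖ ≤ 1 := fun i => φ.le_of_opNorm_le_of_le hφ (he i) |>.trans (by simp)
    have hone := sum_norm_sq_dyadicDiff_le hφe L
    have hwt := sum_dyadic_weight L
    have hbound : ∀ s m, (2 : ℝ) ^ (s + 1) / 2 ^ L * ‖φ (dyadicDiff e s m)‖ ^ p ≤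
        (2 * (t : ℝ))⁻¹ * (2 ^ (s + 1) / 2 ^ L) +
          t / 2 * (2 ^ (s + 1) / 2 ^ L * ‖dyadicDiff (fun i => φ (e i)) s m‖ ^ 2) := by
      intro s m
      rw [map_dyadicDiff]
      set a := ‖dyadicDiff (fun i => φ (e i)) s m‖
      have ha1 : a ^ p ≤ a :=
        Real.rpow_le_self_of_le_one (norm_nonneg _) (norm_dyadicDiff_le_one hφe s m) hp
      have ha2 : a ≤ (2 * (t : ℝ))⁻¹ + t / 2 * a ^ 2 := by
        have : (2 * (t : ℝ))⁻¹ + t / 2 * a ^ 2 - a = (t * a - 1) ^ 2 / (2 * t) := by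
          field_simp
          ring
        have : 0 ≤ (t * a - 1) ^ 2 / (2 * t) := by positivity
        linarith
      have := mul_le_mul_of_nonneg_left (ha1.trans ha2)
        (show (0 : ℝ) ≤ 2 ^ (s + 1) / 2 ^ L by positivity)
      linarith
    rw [Finset.sum_sigma]
    refine (Finset.sum_le_sum fun s _ => Finset.sum_le_sum fun m _ => hbound s m).trans ?_
    simp only [Finset.sum_add_distrib, ← Finset.mul_sum]
    simp only [← Finset.mul_sum] at hone
    have hLt : (2 * (t : ℝ))⁻¹ * L = t / 2 := by
      rw [hL]
      push_cast
      field_simp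
    rw [hwt, hLt]
    nlinarith

end Haar

/-- A point of the union of progressions cannot lie between two consecutive progressions. -/
theorem notMem_iUnion_progression {c n : ℕ → ℕ} (hc : ∀ k, c k + n k * (k + 1) < c (k + 1))
    {k t : ℕ} (h1 : c k + n k * (k + 1) < t) (h2 : t ≤ c (k + 1)) :
    t ∉ ⋃ k : ℕ, (fun i : ℕ => c k + i * (k + 1)) '' Set.Icc 1 (n k) := by
  have hmono : StrictMono c := strictMono_nat_of_lt_succ fun k =>
    (Nat.le_add_right _ _).trans_lt (hc k)
  simp only [Set.mem_iUnion, Set.mem_image, Set.mem_Icc, not_exists]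
  rintro l i ⟨⟨hi1, hi2⟩, rfl⟩
  have hle : c l + i * (l + 1) ≤ c l + n l * (l + 1) :=
    Nat.add_le_add_left (Nat.mul_le_mul_right _ hi2) _
  rcases lt_trichotomy l k with hlk | rfl | hkl
  · have := hmono.monotone (show l + 1 ≤ k from hlk)
    have := hc l
    omega
  · omega
  · have := hmono.monotone (show k + 1 ≤ l from hkl)
    have : l + 1 ≤ i * (l + 1) := Nat.le_mul_of_pos_left _ hi1
    omega

theorem half_le_re_derivSet_delta_delta {S : Set ℕ} {j k : ℕ} (h : j + k ∈ S) (hj : 0 < j)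
    (hkj : k ≤ j) : 2 * (1 / 4 : ℝ) ≤ (derivSet S (delta j) (delta k)).re := by
  rw [derivSet_delta_delta, derivKernel_indicatorInfty_of_mem h, Complex.ofReal_re]
  have hkj' : (k : ℝ) ≤ j := by exact_mod_cast hkj
  have hj' : (0 : ℝ) < j := by exact_mod_cast hj
  rw [le_div_iff₀ (by positivity)]
  linarith

theorem not_isPSumming_derivSet_iUnion_progression {c : ℕ → ℕ}
    (hbase : ∀ k, 2 ^ k * (k + 1) ≤ c k) (hgap : ∀ k, c k + 2 * (2 ^ k * (k + 1)) < c (k + 1))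
    {p : ℝ} (hp : 1 ≤ p) :
    ¬ IsPSumming p (derivSet
      (⋃ k : ℕ, (fun i : ℕ => c k + i * (k + 1)) '' Set.Icc 1 (2 ^ k))) := by
  set A := ⋃ k : ℕ, (fun i : ℕ => c k + i * (k + 1)) '' Set.Icc 1 (2 ^ k) with hA
  have hc : ∀ k, c k + 2 ^ k * (k + 1) < c (k + 1) := fun k => by have := hgap k; omega
  refine not_isPSumming_of_dyadicDiff (r := 1 / 4) (by norm_num) (fun L => ?_) hp
  refine ⟨fun i => delta (c L + (i + 1) * (L + 1)), fun i => (norm_delta _).le, ?_⟩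
  intro s hs m hm
  have hpow : 2 ^ (L - 1 - s) * 2 ^ s * 2 = 2 ^ L := by
    rw [← pow_add, ← pow_succ, show L - 1 - s + s + 1 = L by omega]
  have hmid : (2 * m + 1 + 1) * 2 ^ s ≤ 2 ^ L := by
    rw [← hpow]
    nlinarith [Nat.mul_le_mul_right (2 ^ s) (show m + 1 ≤ 2 ^ (L - 1 - s) from hm)]
  have hstep : (2 * m + 1 + 1) * 2 ^ s = (2 * m + 1) * 2 ^ s + 2 ^ s := by ring
  rw [hstep] at hmid
  set q := (2 * m + 1) * 2 ^ s with hq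
  have hqL : q ≤ 2 ^ L := le_of_add_le_left hmid
  have hsL : 2 ^ s ≤ 2 ^ L := le_of_add_le_right hmid
  set l := (2 ^ L - q) * (L + 1) with hl
  have hindex : ∀ i, c L + (i + 1) * (L + 1) + l = c L + (i + 1 + (2 ^ L - q)) * (L + 1) :=
    fun i => by rw [hl]; ring
  refine le_trans ?_ (((derivSet A _).le_opNorm (delta l)).trans_eq
    (by rw [norm_delta, mul_one]))
  rw [← ContinuousLinearMap.flip_apply, map_dyadicDiff]
  refine le_norm_dyadicDiff (fun i hi => ?_) fun i hi hi' => ?_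
  · have hmem : c L + (i + 1) * (L + 1) + l ∈ A := by
      rw [hindex, hA]
      exact Set.mem_iUnion.2 ⟨L, _, ⟨by omega, by omega⟩, rfl⟩
    have hl1 : l ≤ c L + (i + 1) * (L + 1) := by
      have : l ≤ 2 ^ L * (L + 1) := Nat.mul_le_mul_right _ (Nat.sub_le _ _)
      have := hbase L
      omega
    rw [ContinuousLinearMap.flip_apply]
    exact half_le_re_derivSet_delta_delta hmem (by positivity) hl1
  · have hnot : c L + (i + 1) * (L + 1) + l ∉ A := by
      rw [hindex, hA]
      have h1 : (2 ^ L + 1) * (L + 1) ≤ (i + 1 + (2 ^ L - q)) * (L + 1) :=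
        Nat.mul_le_mul_right _ (by omega)
      have h2 : (i + 1 + (2 ^ L - q)) * (L + 1) ≤ (2 * 2 ^ L) * (L + 1) :=
        Nat.mul_le_mul_right _ (by rw [hstep] at hi'; omega)
      have h3 := hgap L
      refine notMem_iUnion_progression (n := fun k => 2 ^ k) hc (k := L) ?_ ?_ <;> nlinarith
    rw [ContinuousLinearMap.flip_apply, derivSet_delta_delta,
      derivKernel_indicatorInfty_of_notMem hnot]

theorem theoremA3 :
    ∃ (A : Set ℕ) (c n : ℕ → ℕ),
      (∀ k, 1 ≤ n k) ∧
      (∀ k, c k + n k * (k + 1) < c (k + 1)) ∧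
      A = ⋃ k : ℕ, (fun i : ℕ => c k + i * (k + 1)) '' Set.Icc 1 (n k) ∧
      IsTSet A ∧
      IsDerivation (derivSet A) ∧
      IsWeaklyCompactOp (derivSet A) ∧
      ∀ p : ℝ, 1 ≤ p → ¬ IsPSumming p (derivSet A) := by
  have hbase : ∀ k, 2 ^ k * (k + 1) ≤ 4 ^ k := fun k => by
    rw [show 4 = 2 * 2 from rfl, mul_pow]
    exact Nat.mul_le_mul_left _ Nat.lt_two_pow_self
  have hgap : ∀ k, 4 ^ k + 2 * (2 ^ k * (k + 1)) < 4 ^ (k + 1) := fun k => by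
    have := hbase k
    have : 0 < 4 ^ k := by positivity
    rw [pow_succ]
    omega
  have hc : ∀ k, 4 ^ k + 2 ^ k * (k + 1) < 4 ^ (k + 1) := fun k => by have := hgap k; omega
  have hT := isTSet_iUnion_progression (c := fun k => 4 ^ k) (n := fun k => 2 ^ k) hc
  exact ⟨_, fun k => 4 ^ k, fun k => 2 ^ k, fun k => Nat.one_le_two_pow, hc, rfl, hT,
    isDerivation_derivOp _, hT.isWeaklyCompactOp_derivSet,
    fun p hp => not_isPSumming_derivSet_iUnion_progression hbase hgap hp⟩
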